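/- A deterministic comparison-based algorithm on $n$ elements is a finite binary decision tree: every inner node compares two of the elements and continues according to which of them is smaller, and every leaf outputs an element. A randomized comparison-based algorithm is a probability distribution on such trees. It is a minimum-finding algorithm if, on every input of $n$ pairwise distinct real values and for every outcome of its random choices, it outputs the element with the smallest value. It has fragile complexity at most $\Delta$ if, on every such input and for every outcome of its random choices, each individual element takes part in at most $\Delta$ comparisons. Theorem. In any randomized minimum-finding algorithm with fragile complexity at most $\Delta$, the expected number of comparisons of the minimum is $\Omega(\log_\Delta n)$ in the worst case over the inputs. Precisely: there is an absolute constant $c>0$ such that for all integers $n\ge 1$ and $\Delta\ge 2$ and every randomized minimum-finding algorithm on $n$ elements with fragile complexity at most $\Delta$, there is an input $x_1,\dots,x_n$ of pairwise distinct real numbers on which the expected number (over the random choices of the algorithm) of comparisons in which the minimum element takes part is at least $c\,\log_\Delta n$. -/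

import Mathlib

open scoped ENNReal

/-- A deterministic comparison-based algorithm on the input elements `0, …, n - 1`
that outputs one of the elements, as a binary decision tree. Nothing but the outcomes of
comparisons is available to it; elements may be compared adaptively and repeatedly. -/
inductive ComparisonTree (n : ℕ) : Type
  /-- Stop and output the element `m`. -/
  | leaf (m : Fin n) : ComparisonTree n
  /-- Compare the elements `i` and `j`; continue with `yes` if `i` is smaller than `j`,
  and with `no` otherwise. -/
  | node (i j : Fin n) (yes no : ComparisonTree n) : ComparisonTree n

namespace ComparisonTree

/-- The element that the algorithm outputs when element `i` has value `x i`. -/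
noncomputable def output {n : ℕ} : ComparisonTree n → (Fin n → ℝ) → Fin n
  | leaf m, _ => m
  | node i j yes no, x => if x i < x j then yes.output x else no.output x

/-- The number of comparisons in which element `e` takes part when the algorithm runs
on the input `x`. -/
noncomputable def comparisons {n : ℕ} : ComparisonTree n → (Fin n → ℝ) → Fin n → ℕ
  | leaf _, _, _ => 0
  | node i j yes no, x, e =>
      (if e = i ∨ e = j then 1 else 0) +
        (if x i < x j then yes.comparisons x e else no.comparisons x e)

/-- The algorithm outputs the minimum, on every input with pairwise distinct values. -/
def FindsMinimum {n : ℕ} (t : ComparisonTree n) : Prop :=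
  ∀ x : Fin n → ℝ, Function.Injective x → ∀ j : Fin n, x (t.output x) ≤ x j

/-- The algorithm has fragile complexity at most `Δ`: on every input, every individual
element takes part in at most `Δ` comparisons. -/
def FragileComplexityLE {n : ℕ} (t : ComparisonTree n) (Δ : ℕ) : Prop :=
  ∀ x : Fin n → ℝ, Function.Injective x → ∀ e : Fin n, t.comparisons x e ≤ Δ

end ComparisonTree

/-- A randomized comparison-based algorithm: a random choice of a deterministic one. Decision
trees form a countable set, so that discrete distributions are all distributions. -/
abbrev RandomizedComparisonAlgorithm (n : ℕ) : Type := PMF (ComparisonTree n)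

namespace RandomizedComparisonAlgorithm

/-- The algorithm outputs the minimum, on every input and for every outcome of its coins. -/
def FindsMinimum {n : ℕ} (A : RandomizedComparisonAlgorithm n) : Prop :=
  ∀ t ∈ A.support, t.FindsMinimum

/-- Every element takes part in at most `Δ` comparisons, on every input and for every outcome
of the coins. -/
def FragileComplexityLE {n : ℕ} (A : RandomizedComparisonAlgorithm n) (Δ : ℕ) : Prop :=
  ∀ t ∈ A.support, t.FragileComplexityLE Δ

/-- The expected number, over the coins of the algorithm, of comparisons in which element `e`
takes part on the fixed input `x`. -/
noncomputable def expectedComparisons {n : ℕ} (A : RandomizedComparisonAlgorithm n)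
    (x : Fin n → ℝ) (e : Fin n) : ℝ≥0∞ :=
  ∑' t : ComparisonTree n, A t * (t.comparisons x e : ℝ≥0∞)

end RandomizedComparisonAlgorithm

/-! Run a deterministic tree on a uniformly random order, and cut the positive ranks into blocks `[D
^ j, D ^ (j + 1))` with `D = 2 * Δ + 1`. In at least half of all orders the minimum `m` meets a
given block `[a, b)`. Otherwise, raise `m` to any rank `r` in a block that it misses. The output
must change, and only comparisons of `m` with elements formerly below rank `a` can reveal the
change, so in the new order `m` meets one of the `a - 1` smallest elements
(`FindsMinimum.exists_meets_raiseZero`). Fragility allows at most `(a - 1) * Δ` such `m` per order.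
The pair of new order and `m` determines the old order and `r`, so double counting bounds the bad
orders (`card_not_meets_mul_le`).

Distinct blocks give distinct partners, so the average number of comparisons is at least half the
number of blocks. Averaging over the coins as well yields one bad order for the randomized
algorithm. -/

namespace ComparisonTree

variable {n : ℕ}

/-! ### Partners of an element and indistinguishable inputs -/

/-- On the input `x`, the algorithm compares the elements `e` and `f`. -/
def Meets : ComparisonTree n → (Fin n → ℝ) → Fin n → Fin n → Prop
  | leaf _, _, _, _ => False
  | node i j yes no, x, e, f =>
      (e = i ∧ f = j ∨ e = j ∧ f = i) ∨
        (if x i < x j then yes.Meets x e f else no.Meets x e f)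

theorem Meets.symm {t : ComparisonTree n} {x : Fin n → ℝ} {e f : Fin n} (h : t.Meets x e f) :
    t.Meets x f e := by
  induction t with
  | leaf => exact h
  | node i j yes no ihy ihn =>
    simp only [Meets] at h ⊢
    split_ifs at h ⊢ <;> tauto

open Classical in
/-- The number of partners of an element is at most the number of its comparisons. -/
theorem card_meets_le (t : ComparisonTree n) (x : Fin n → ℝ) (e : Fin n) :
    (Finset.univ.filter fun f => t.Meets x e f).card ≤ t.comparisons x e := by
  induction t with
  | leaf m =>
    rw [Finset.card_eq_zero.2 (Finset.filter_eq_empty_iff.2 fun f _ (h : (leaf m).Meets x e f) => h)]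
    exact Nat.zero_le _
  | node i j yes no ihy ihn =>
    have hsub : (Finset.univ.filter fun f => (node i j yes no).Meets x e f) ⊆
        (Finset.univ.filter fun f => e = i ∧ f = j ∨ e = j ∧ f = i) ∪
          Finset.univ.filter fun f => if x i < x j then yes.Meets x e f else no.Meets x e f := by
      intro f hf
      exact Finset.mem_union.2 ((Finset.mem_filter.1 hf).2.imp
        (fun h => Finset.mem_filter.2 ⟨Finset.mem_univ _, h⟩)
        fun h => Finset.mem_filter.2 ⟨Finset.mem_univ _, h⟩)
    refine (Finset.card_le_card hsub).trans
      ((Finset.card_union_le _ _).trans (add_le_add ?_ ?_))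
    · split_ifs with h
      · refine Finset.card_le_one.2 fun a ha b hb => ?_
        simp only [Finset.mem_filter, Finset.mem_univ, true_and] at ha hb
        grind
      · push Not at h
        simp [h.1, h.2]
    · split_ifs
      · exact ihy
      · exact ihn

/-- Let `x` and `y` order all pairs alike, except for pairs of `m` and an element of `S` or `W`.
If `m` meets no element of `W` on `x`, then the outputs on `x` and `y` agree unless `m` meets
an element of `S` on `y`. -/
theorem exists_meets_or_output_eq (t : ComparisonTree n) {x y : Fin n → ℝ} {m : Fin n}
    {S W : Fin n → Prop}
    (hxy : ∀ i j, i ≠ m → j ≠ m → (x i < x j ↔ y i < y j))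
    (hm : ∀ f, ¬ S f → ¬ W f → (x m < x f ↔ y m < y f) ∧ (x f < x m ↔ y f < y m))
    (hW : ∀ f, W f → ¬ t.Meets x m f) :
    (∃ f, S f ∧ t.Meets y m f) ∨ t.output x = t.output y := by
  induction t with
  | leaf => exact Or.inr rfl
  | node i j yes no ihy ihn =>
    -- Both runs are at the same node. Unless it compares `m` with an element of `S`, both inputs
    -- give the same answer, since `hW` rules out `W`.
    by_cases hS : ∃ f, S f ∧ (m = i ∧ f = j ∨ m = j ∧ f = i)
    · obtain ⟨f, hf, h⟩ := hS
      exact Or.inl ⟨f, hf, Or.inl h⟩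
    · have hij : x i < x j ↔ y i < y j := by
        by_cases hi : m = i
        · have hWj : ¬ W j := fun h => hW j h (Or.inl (Or.inl ⟨hi, rfl⟩))
          have hSj : ¬ S j := fun h => hS ⟨j, h, Or.inl ⟨hi, rfl⟩⟩
          exact hi ▸ (hm j hSj hWj).1
        · by_cases hj : m = j
          · have hWi : ¬ W i := fun h => hW i h (Or.inl (Or.inr ⟨hj, rfl⟩))
            have hSi : ¬ S i := fun h => hS ⟨i, h, Or.inr ⟨hj, rfl⟩⟩
            exact hj ▸ (hm i hSi hWi).2
          · exact hxy i j (Ne.symm hi) (Ne.symm hj)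
      simp only [Meets, output]
      by_cases hlt : x i < x j
      · have hlt' := hij.1 hlt
        simp only [Meets, hlt, if_true] at hW
        simp only [hlt, hlt', if_true]
        exact (ihy fun f hf h => hW f hf (Or.inr h)).imp_left
          fun ⟨f, hf, h⟩ => ⟨f, hf, Or.inr h⟩
      · have hlt' := mt hij.2 hlt
        simp only [Meets, hlt, if_false] at hW
        simp only [hlt, hlt', if_false]
        exact (ihn fun f hf h => hW f hf (Or.inr h)).imp_left
          fun ⟨f, hf, h⟩ => ⟨f, hf, Or.inr h⟩

end ComparisonTree

/-! ### Orders as inputs, and raising the minimum -/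

/-- The input on which the element `e` has the value `σ e`. -/
def permInput {n : ℕ} (σ : Equiv.Perm (Fin n)) (e : Fin n) : ℝ := ((σ e : ℕ) : ℝ)

theorem permInput_lt {n : ℕ} {σ : Equiv.Perm (Fin n)} {e f : Fin n} :
    permInput σ e < permInput σ f ↔ σ e < σ f := by
  simp [permInput]

theorem permInput_le {n : ℕ} {σ : Equiv.Perm (Fin n)} {e f : Fin n} :
    permInput σ e ≤ permInput σ f ↔ σ e ≤ σ f := by
  simp [permInput]

theorem permInput_injective {n : ℕ} (σ : Equiv.Perm (Fin n)) :
    Function.Injective (permInput σ) := fun e f h => by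
  simpa [permInput, Fin.val_inj] using h

/-- The values of `σ`, changed by moving the value `0` up to `r` and the values `1, …, r` down
by one. -/
def raiseZero {N : ℕ} (σ : Equiv.Perm (Fin (N + 1))) (r : Fin (N + 1)) :
    Equiv.Perm (Fin (N + 1)) := σ.trans r.cycleRange.symm

section raiseZero

variable {N : ℕ} (σ : Equiv.Perm (Fin (N + 1))) (r : Fin (N + 1))

theorem raiseZero_symm_zero : raiseZero σ r (σ.symm 0) = r := by
  simp [raiseZero]

theorem exists_eq_succ_of_ne {e : Fin (N + 1)} (h : e ≠ σ.symm 0) :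
    ∃ k : Fin N, σ e = k.succ ∧ raiseZero σ r e = r.succAbove k := by
  have h0 : σ e ≠ 0 := fun h' => h (by simp [← h'])
  obtain ⟨k, hk⟩ := Fin.exists_succ_eq.2 h0
  exact ⟨k, hk.symm, by simp [raiseZero, ← hk]⟩

theorem raiseZero_lt_iff {e f : Fin (N + 1)} (he : e ≠ σ.symm 0) (hf : f ≠ σ.symm 0) :
    raiseZero σ r e < raiseZero σ r f ↔ σ e < σ f := by
  obtain ⟨k, hk, hk'⟩ := exists_eq_succ_of_ne σ r he
  obtain ⟨l, hl, hl'⟩ := exists_eq_succ_of_ne σ r hf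
  rw [hk, hk', hl, hl', Fin.succAbove_lt_succAbove_iff, Fin.succ_lt_succ_iff]

theorem raiseZero_val_of_le {e : Fin (N + 1)} (h0 : σ e ≠ 0) (h : σ e ≤ r) :
    (raiseZero σ r e : ℕ) + 1 = σ e := by
  obtain ⟨k, hk, hk'⟩ := exists_eq_succ_of_ne σ r (e := e) fun h' => h0 (by simp [h'])
  rw [hk] at h
  rw [hk, hk', Fin.succAbove_of_castSucc_lt _ _ (by
    rw [Fin.lt_def]; rw [Fin.le_def] at h; simp at h ⊢; omega)]
  simp

theorem raiseZero_of_lt {e : Fin (N + 1)} (h : r < σ e) : raiseZero σ r e = σ e := by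
  have h0 : σ e ≠ 0 := fun h0 => by simp [h0] at h
  obtain ⟨k, hk, hk'⟩ := exists_eq_succ_of_ne σ r (e := e) fun h' => h0 (by simp [h'])
  rw [hk] at h
  rw [hk, hk', Fin.succAbove_of_le_castSucc _ _ (by
    rw [Fin.le_def]; rw [Fin.lt_def] at h; simp at h ⊢; omega)]

end raiseZero

/-- The raised element is known, so its new rank reveals `r`, and the cycle can be undone. -/
theorem raiseZero_injective {N : ℕ} {σ τ : Equiv.Perm (Fin (N + 1))} {r s : Fin (N + 1)}
    (h : raiseZero σ r = raiseZero τ s) (h0 : σ.symm 0 = τ.symm 0) : σ = τ ∧ r = s := by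
  have hrs : r = s := by
    rw [← raiseZero_symm_zero σ r, ← raiseZero_symm_zero τ s, h, h0]
  subst hrs
  refine ⟨Equiv.ext fun e => ?_, rfl⟩
  have := congrArg (fun p => r.cycleRange (p e)) h
  simpa [raiseZero] using this

/-! ### Double counting for deterministic trees -/

namespace ComparisonTree

variable {N : ℕ} {t : ComparisonTree (N + 1)}

/-- If the minimum meets no element with rank in `[a, b)`, and is then raised to a rank in that
interval, it meets an element of rank less than `a - 1`. -/
theorem FindsMinimum.exists_meets_raiseZero (ht : t.FindsMinimum)
    {σ : Equiv.Perm (Fin (N + 1))} {a b : ℕ} (ha : 1 ≤ a)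
    (hσ : ∀ f, a ≤ (σ f : ℕ) → (σ f : ℕ) < b → ¬ t.Meets (permInput σ) (σ.symm 0) f)
    {r : Fin (N + 1)} (har : a ≤ (r : ℕ)) (hrb : (r : ℕ) < b) :
    ∃ f, (raiseZero σ r f : ℕ) < a - 1 ∧
      t.Meets (permInput (raiseZero σ r)) (σ.symm 0) f := by
  set m := σ.symm 0 with hm
  have hσm : σ m = 0 := by simp [hm]
  have hrm : raiseZero σ r m = r := raiseZero_symm_zero σ r
  rcases exists_meets_or_output_eq t (x := permInput σ) (y := permInput (raiseZero σ r)) (m := m)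
    -- Outside `S` and `W` there are only `m` and ranks at least `b > r`, whose order relative to
    -- `m` survives the raise.
    (S := fun f => σ f ≠ 0 ∧ (σ f : ℕ) < a) (W := fun f => a ≤ (σ f : ℕ) ∧ (σ f : ℕ) < b)
    (fun i j hi hj => by rw [permInput_lt, permInput_lt, raiseZero_lt_iff σ r hi hj])
    (fun f hS hW => by
      by_cases hf : f = m
      · subst hf; simp
      · have h0 : σ f ≠ 0 := fun h => hf (by simp [hm, ← h])
        have hlt : r < σ f := by
          rw [Fin.lt_def]
          have h1 : ¬ (σ f : ℕ) < a := fun h => hS ⟨h0, h⟩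
          by_contra h2
          exact hW ⟨by omega, by omega⟩
        simp only [permInput_lt, hσm, hrm, raiseZero_of_lt σ r hlt]
        simp [hlt, Fin.pos_iff_ne_zero.2 h0, hlt.le])
    (fun f hf => hσ f hf.1 hf.2) with ⟨f, ⟨h0, hfa⟩, hf⟩ | h
  · refine ⟨f, ?_, hf⟩
    -- Ranks in `[1, a)` drop by one, hence the bound `a - 1`; for `a = 1` it leaves no bad order at
    -- all.
    have := raiseZero_val_of_le σ r h0 (Fin.le_def.2 (by omega))
    omega
  · exfalso
    have h1 : t.output (permInput σ) = m := by
      have := permInput_le.1 (ht _ (permInput_injective σ) m)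
      rw [hσm, Fin.le_zero_iff] at this
      simp [hm, ← this]
    have h2 := permInput_le.1 (ht _ (permInput_injective (raiseZero σ r)) ((raiseZero σ r).symm 0))
    rw [← h, h1, hrm, Equiv.apply_symm_apply, Fin.le_zero_iff] at h2
    simp [h2] at har
    omega

open Classical in
/-- The number of elements that meet an element of rank less than `s`. -/
theorem FragileComplexityLE.card_meets_le {Δ : ℕ} (ht : t.FragileComplexityLE Δ)
    (σ : Equiv.Perm (Fin (N + 1))) (s : ℕ) :
    (Finset.univ.filter fun m => ∃ f, (σ f : ℕ) < s ∧ t.Meets (permInput σ) m f).card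
      ≤ s * Δ := by
  have hsub : (Finset.univ.filter fun m => ∃ f, (σ f : ℕ) < s ∧ t.Meets (permInput σ) m f) ⊆
      (Finset.univ.filter fun f => (σ f : ℕ) < s).biUnion
        fun f => Finset.univ.filter fun m => t.Meets (permInput σ) f m := by
    intro m hm
    simp only [Finset.mem_filter, Finset.mem_univ, true_and, Finset.mem_biUnion] at hm ⊢
    obtain ⟨f, hf, h⟩ := hm
    exact ⟨f, hf, h.symm⟩
  have hcard : (Finset.univ.filter fun f => (σ f : ℕ) < s).card ≤ s := by
    rw [← Finset.card_range s]
    refine Finset.card_le_card_of_injOn (fun f => (σ f : ℕ)) (fun f hf => by simpa using hf) ?_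
    intro e _ f _ h
    simpa [Fin.val_inj] using h
  refine (Finset.card_le_card hsub).trans ((Finset.card_biUnion_le_card_mul _ _ Δ ?_).trans
    (Nat.mul_le_mul_right _ hcard))
  exact fun f _ => (t.card_meets_le _ f).trans (ht _ (permInput_injective σ) f)

open Classical in
/-- The number of orders in which the minimum meets no element with rank in `[a, b)`. -/
theorem card_not_meets_mul_le {Δ : ℕ} (ht : t.FindsMinimum) (hΔ : t.FragileComplexityLE Δ)
    {a b : ℕ} (ha : 1 ≤ a) (hb : b ≤ N + 1) :
    (Finset.univ.filter fun σ : Equiv.Perm (Fin (N + 1)) =>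
        ∀ f, a ≤ (σ f : ℕ) → (σ f : ℕ) < b → ¬ t.Meets (permInput σ) (σ.symm 0) f).card
      * (b - a) ≤ (N + 1).factorial * ((a - 1) * Δ) := by
  set B := Finset.univ.filter fun σ : Equiv.Perm (Fin (N + 1)) =>
        ∀ f, a ≤ (σ f : ℕ) → (σ f : ℕ) < b → ¬ t.Meets (permInput σ) (σ.symm 0) f with hB
  set R : Finset (Fin (N + 1)) := Finset.univ.filter fun r => a ≤ (r : ℕ) ∧ (r : ℕ) < b with hR
  have hRc : b - a ≤ R.card := by
    rw [← Nat.card_Ico]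
    refine Finset.card_le_card_of_surjOn (fun r : Fin (N + 1) => (r : ℕ)) fun k hk => ?_
    have hk' := Finset.mem_Ico.1 (Finset.mem_coe.1 hk)
    exact ⟨⟨k, by omega⟩, by simpa [hR] using hk', rfl⟩
  let Q : Equiv.Perm (Fin (N + 1)) → Finset (Fin (N + 1)) := fun τ =>
    Finset.univ.filter fun m => ∃ f, (τ f : ℕ) < a - 1 ∧ t.Meets (permInput τ) m f
  calc B.card * (b - a) ≤ B.card * R.card := Nat.mul_le_mul_left _ hRc
    _ = (B ×ˢ R).card := (Finset.card_product _ _).symm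
    _ ≤ (Finset.univ.sigma Q).card := by
      refine Finset.card_le_card_of_injOn
        (fun p => (⟨raiseZero p.1 p.2, p.1.symm 0⟩ : Σ _ : Equiv.Perm (Fin (N + 1)), Fin (N + 1)))
        ?_ ?_
      · rintro ⟨σ, r⟩ hp
        have hp' := Finset.mem_product.1 (Finset.mem_coe.1 hp)
        simp only [hB, hR, Finset.mem_filter, Finset.mem_univ, true_and] at hp'
        simpa [Q] using ht.exists_meets_raiseZero ha hp'.1 hp'.2.1 hp'.2.2
      · rintro ⟨σ, r⟩ _ ⟨τ, s⟩ _ h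
        simp only [Sigma.mk.injEq, heq_eq_eq] at h
        obtain ⟨h1, h2⟩ := raiseZero_injective h.1 h.2
        rw [h1, h2]
    _ = ∑ τ, (Q τ).card := Finset.card_sigma _ _
    _ ≤ ∑ _τ : Equiv.Perm (Fin (N + 1)), (a - 1) * Δ :=
      Finset.sum_le_sum fun τ _ => hΔ.card_meets_le τ (a - 1)
    _ = (N + 1).factorial * ((a - 1) * Δ) := by
      simp [Fintype.card_perm]

open Classical in
/-- In at least half of all orders the minimum meets an element with rank in `[a, b)`. -/
theorem factorial_le_two_mul_card_meets {Δ : ℕ} (ht : t.FindsMinimum)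
    (hΔ : t.FragileComplexityLE Δ) {a b : ℕ} (ha : 1 ≤ a) (hab : a < b) (hb : b ≤ N + 1)
    (h : 2 * ((a - 1) * Δ) ≤ b - a) :
    (N + 1).factorial ≤ 2 * (Finset.univ.filter fun σ : Equiv.Perm (Fin (N + 1)) =>
        ∃ f, (a ≤ (σ f : ℕ) ∧ (σ f : ℕ) < b) ∧
          t.Meets (permInput σ) (σ.symm 0) f).card := by
  have h1 := card_not_meets_mul_le ht hΔ ha hb
  have h2 := Finset.card_filter_add_card_filter_not (s := Finset.univ)
    fun σ : Equiv.Perm (Fin (N + 1)) =>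
      ∃ f, (a ≤ (σ f : ℕ) ∧ (σ f : ℕ) < b) ∧ t.Meets (permInput σ) (σ.symm 0) f
  simp only [not_exists, not_and, and_imp, Finset.card_univ, Fintype.card_perm,
    Fintype.card_fin] at h2
  set B := (Finset.univ.filter fun σ : Equiv.Perm (Fin (N + 1)) =>
        ∀ f, a ≤ (σ f : ℕ) → (σ f : ℕ) < b → ¬ t.Meets (permInput σ) (σ.symm 0) f).card
  have h3 : 2 * B ≤ (N + 1).factorial := by
    refine Nat.le_of_mul_le_mul_right (c := b - a) ?_ (by omega)
    calc 2 * B * (b - a) = 2 * (B * (b - a)) := by ring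
      _ ≤ 2 * ((N + 1).factorial * ((a - 1) * Δ)) := Nat.mul_le_mul_left _ h1
      _ = (N + 1).factorial * (2 * ((a - 1) * Δ)) := by ring
      _ ≤ (N + 1).factorial * (b - a) := Nat.mul_le_mul_left _ h
  omega

/-- A lower bound for the number of comparisons of the minimum, summed over all orders. -/
theorem factorial_mul_le_two_mul_sum_comparisons {Δ : ℕ} (ht : t.FindsMinimum)
    (hΔ : t.FragileComplexityLE Δ) (hΔ1 : 1 ≤ Δ) (hN : 1 ≤ N) :
    (N + 1).factorial * max 1 (Nat.log (2 * Δ + 1) (N + 1)) ≤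
      2 * ∑ σ : Equiv.Perm (Fin (N + 1)), t.comparisons (permInput σ) (σ.symm 0) := by
  classical
  set D := 2 * Δ + 1 with hD
  set K := max 1 (Nat.log D (N + 1)) with hK
  have hpos : ∀ j, 1 ≤ D ^ j := fun j => Nat.one_le_pow _ _ (by omega)
  let P : ℕ → Equiv.Perm (Fin (N + 1)) → Prop := fun j σ =>
    ∃ f, (D ^ j ≤ (σ f : ℕ) ∧ (σ f : ℕ) < min (N + 1) (D ^ (j + 1))) ∧
      t.Meets (permInput σ) (σ.symm 0) f
  have hhalf : ∀ j ∈ Finset.range K, (N + 1).factorial ≤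
      2 * (Finset.univ.filter fun σ => P j σ).card := by
    intro j hj
    have hjK := Finset.mem_range.1 hj
    have hs : D ^ (j + 1) = D ^ j + 2 * (D ^ j * Δ) := by rw [pow_succ, hD]; ring
    have hDΔ : D ^ j ≤ D ^ j * Δ := Nat.le_mul_of_pos_right _ hΔ1
    have hle : (D ^ j - 1) * Δ ≤ D ^ j * Δ := Nat.mul_le_mul_right _ (Nat.sub_le _ _)
    have hj' := hpos j
    by_cases hlog : D ^ (j + 1) ≤ N + 1
    · refine factorial_le_two_mul_card_meets ht hΔ (hpos j) ?_ (min_le_left _ _) ?_ <;>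
        rw [min_eq_right hlog] <;> omega
    -- Only block `0` can be truncated by `N + 1`. There `a - 1 = 0`, so any nonempty block
    -- suffices; this justifies the `max 1`.
    · have hj0 : j = 0 := by
        by_contra hj0
        refine hlog (Nat.pow_le_of_le_log (by omega) ?_)
        omega
      subst hj0
      have hD0 : D ^ 0 = 1 := pow_zero D
      refine factorial_le_two_mul_card_meets ht hΔ (hpos 0) ?_ (min_le_left _ _) ?_
      · rw [lt_min_iff]; constructor <;> omega
      · simp
  have hcomp : ∀ σ : Equiv.Perm (Fin (N + 1)),
      ((Finset.range K).filter fun j => P j σ).card ≤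
        t.comparisons (permInput σ) (σ.symm 0) := by
    intro σ
    refine le_trans ?_ (t.card_meets_le (permInput σ) (σ.symm 0))
    -- The logarithm of a partner's rank recovers its block, so each block that is met costs a
    -- separate partner.
    refine le_trans (Finset.card_le_card ?_)
      (Finset.card_image_le (f := fun f => Nat.log D (σ f : ℕ)))
    intro j hj
    obtain ⟨f, ⟨h1, h2⟩, h3⟩ := (Finset.mem_filter.1 hj).2
    exact Finset.mem_image.2 ⟨f, by simpa using h3,
      Nat.log_eq_of_pow_le_of_lt_pow h1 (h2.trans_le (min_le_right _ _))⟩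
  calc (N + 1).factorial * K = ∑ _j ∈ Finset.range K, (N + 1).factorial := by simp [mul_comm]
    _ ≤ ∑ j ∈ Finset.range K, 2 * (Finset.univ.filter fun σ => P j σ).card :=
      Finset.sum_le_sum hhalf
    _ = 2 * ∑ σ, ((Finset.range K).filter fun j => P j σ).card := by
      simp only [← Finset.mul_sum, Finset.card_filter]
      rw [Finset.sum_comm]
    _ ≤ _ := Nat.mul_le_mul_left _ (Finset.sum_le_sum fun σ _ => hcomp σ)

end ComparisonTree

/-! ### Randomized algorithms and the final constant -/

open RandomizedComparisonAlgorithm in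
/-- In some order the expected number of comparisons of the minimum is at least half the average
lower bound for deterministic algorithms. -/
theorem exists_perm_le_expectedComparisons {N Δ : ℕ}
    {A : RandomizedComparisonAlgorithm (N + 1)} (hA : A.FindsMinimum)
    (hΔ : A.FragileComplexityLE Δ) (hΔ1 : 1 ≤ Δ) (hN : 1 ≤ N) :
    ∃ σ : Equiv.Perm (Fin (N + 1)), (max 1 (Nat.log (2 * Δ + 1) (N + 1)) : ℕ) ≤
      2 * A.expectedComparisons (permInput σ) (σ.symm 0) := by
  set K := max 1 (Nat.log (2 * Δ + 1) (N + 1))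
  have hsum : ∑ _σ : Equiv.Perm (Fin (N + 1)), (K : ℝ≥0∞) ≤
      ∑ σ : Equiv.Perm (Fin (N + 1)),
        2 * A.expectedComparisons (permInput σ) (σ.symm 0) := by
    calc ∑ _σ : Equiv.Perm (Fin (N + 1)), (K : ℝ≥0∞)
        = ∑' t, A t * (((N + 1).factorial * K : ℕ) : ℝ≥0∞) := by
          rw [ENNReal.tsum_mul_right, A.tsum_coe]
          simp [Fintype.card_perm]
      _ ≤ ∑' t, A t * ((2 * ∑ σ : Equiv.Perm (Fin (N + 1)),
            t.comparisons (permInput σ) (σ.symm 0) : ℕ) : ℝ≥0∞) := by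
          refine ENNReal.tsum_le_tsum fun t => ?_
          by_cases ht : t ∈ A.support
          · exact mul_le_mul' le_rfl (Nat.cast_le.2
              (ComparisonTree.factorial_mul_le_two_mul_sum_comparisons (hA t ht) (hΔ t ht)
                hΔ1 hN))
          · simp [(PMF.apply_eq_zero_iff A t).2 ht]
      _ = _ := by
          simp only [expectedComparisons, ← Finset.mul_sum]
          rw [← Summable.tsum_finsetSum fun _ _ => ENNReal.summable, ← ENNReal.tsum_mul_left]
          refine tsum_congr fun t => ?_
          rw [← Finset.mul_sum]
          push_cast
          ring
  obtain ⟨σ, -, h⟩ := ENNReal.exists_le_of_sum_le Finset.univ_nonempty hsum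
  exact ⟨σ, h⟩

/-- Since `2 * Δ + 1 ≤ Δ ^ 3` for `Δ ≥ 2`, changing the base costs a factor 3; rounding `L + 1` to
`2 * max 1 L` costs another 2. -/
theorem logb_le_six_mul_max_log {n Δ : ℕ} (hn : 1 ≤ n) (hΔ : 2 ≤ Δ) :
    Real.logb Δ n ≤ 6 * (max 1 (Nat.log (2 * Δ + 1) n) : ℕ) := by
  set L := Nat.log (2 * Δ + 1) n
  have h1 : n < (2 * Δ + 1) ^ (L + 1) := Nat.lt_pow_succ_log_self (by omega) n
  have h2 : 2 * Δ + 1 ≤ Δ ^ 3 := by nlinarith [Nat.mul_le_mul hΔ hΔ]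
  have h3 : n ≤ Δ ^ (3 * (L + 1)) := by
    rw [pow_mul]
    exact h1.le.trans (Nat.pow_le_pow_left h2 _)
  have hΔ' : (1 : ℝ) < Δ := by exact_mod_cast hΔ
  have h4 : Real.logb Δ n ≤ ((3 * (L + 1) : ℕ) : ℝ) := by
    rw [Real.logb_le_iff_le_rpow hΔ' (by exact_mod_cast hn), Real.rpow_natCast]
    exact_mod_cast h3
  refine h4.trans ?_
  have h5 : 3 * (L + 1) ≤ 6 * max 1 L := by omega
  exact_mod_cast h5

theorem mainTheorem2 :
    ∃ c : ℝ, 0 < c ∧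
      ∀ (n Δ : ℕ), 2 ≤ Δ → ∀ A : RandomizedComparisonAlgorithm n,
        RandomizedComparisonAlgorithm.FindsMinimum A →
        RandomizedComparisonAlgorithm.FragileComplexityLE A Δ →
        ∃ (x : Fin n → ℝ) (m : Fin n), Function.Injective x ∧ (∀ j : Fin n, x m ≤ x j) ∧
          ENNReal.ofReal (c * Real.logb (Δ : ℝ) (n : ℝ)) ≤
            RandomizedComparisonAlgorithm.expectedComparisons A x m := by
  -- The constant combines 1/2 from the half of the orders with 1/6 from the change of base.
  refine ⟨1 / 12, by norm_num, fun n Δ hΔ A hA hfrag => ?_⟩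
  obtain _ | N := n
  -- For `n = 0` no tree exists, as a leaf would name an element.
  · obtain ⟨t, -⟩ := A.support_nonempty
    exact (t.output fun _ => 0).elim0
  obtain rfl | hN := Nat.eq_zero_or_pos N
  · exact ⟨fun _ => 0, 0, fun a b _ => Fin.ext (by omega), fun _ => le_rfl, by simp⟩
  obtain ⟨σ, hσ⟩ := exists_perm_le_expectedComparisons hA hfrag (by omega) hN
  refine ⟨permInput σ, σ.symm 0, permInput_injective σ, fun j => by simp [permInput_le], ?_⟩
  have hlog := logb_le_six_mul_max_log (n := N + 1) (by omega) hΔ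
  set K := max 1 (Nat.log (2 * Δ + 1) (N + 1))
  have h2 : ENNReal.ofReal ((K : ℝ) / 2) = (K : ℝ≥0∞) / 2 := by
    rw [ENNReal.ofReal_div_of_pos (by norm_num)]
    simp
  calc ENNReal.ofReal (1 / 12 * Real.logb (Δ : ℝ) ((N + 1 : ℕ) : ℝ))
      ≤ ENNReal.ofReal ((K : ℝ) / 2) := ENNReal.ofReal_le_ofReal (by linarith)
    _ = (K : ℝ≥0∞) / 2 := h2
    _ ≤ _ := ENNReal.div_le_of_le_mul' hσ
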